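/- Theorem ($3\times 3$-Lemma). Let $\mathcal C$ be a regular unital category with binary coproducts (so $\mathcal C$ is pointed with finite limits and, for all $A,B$, any monomorphism through which both $\langle 1_A,0\rangle\colon A\to A\times B$ and $\langle 0,1_B\rangle\colon B\to A\times B$ factor is an isomorphism). Let $(P,\delta,\varepsilon)$ be a comonad on $\mathcal C$ such that every $\varepsilon_X\colon P(X)\to X$ is a regular epimorphism and every object $P(X)$ is projective with respect to regular epimorphisms. An imaginary morphism $a\colon X\dashrightarrow Y$ is a morphism $a\colon P(X)\to Y$ of $\mathcal C$; the composite of $a\colon X\dashrightarrow Y$ and $b\colon Y\dashrightarrow Z$ is $b\circ a=b\,P(a)\,\delta_X$, and a morphism $f\colon X\to Y$ of $\mathcal C$ gives the imaginary morphism $\overline f=f\varepsilon_X$. (Composites of a morphism with an imaginary one are taken by identifying $f$ with $\overline f$, and $\langle -,-\rangle$ denotes pairing into the product of $\mathcal C$.) Let $t=(t_{A,B}\colon P(A\times B)\to A+B)_{A,B}$ be a natural imaginary splitting, that is, a family natural in $A$ and $B$ such that $r_{A,B}\,t_{A,B}=\varepsilon_{A\times B}$, where $r_{A,B}\colon A+B\to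 A\times B$ is the canonical morphism with components $\langle 1_A,0\rangle$ and $\langle 0,1_B\rangle$. Let $\mu^X\colon X\times X\dashrightarrow X$ be the imaginary addition $\nabla_X\, t_{X,X}$, where $\nabla_X\colon X+X\to X$ is the codiagonal, and assume that it is associative: $\mu^X\circ\langle \mu^X\circ\langle a,b\rangle,c\rangle=\mu^X\circ\langle a,\mu^X\circ\langle b,c\rangle\rangle$ for all imaginary morphisms $a,b,c\colon A\dashrightarrow X$. A split epimorphism $f\colon X\to Y$ with section $s$ and kernel $k\colon K\to X$ is intrinsic Schreier if there is an imaginary morphism $q\colon X\dashrightarrow K$ such that $\mu^X\circ\langle k\circ q,\overline{sf}\rangle=\overline{1_X}$ and $q\circ\mu^X\circ(k\times s)=\overline{\pi_K}$, where $\pi_K\colon K\times Y\to K$ is the projection. A morphism $f\colon X\to Y$ is an intrinsic Schreier special morphism if the first projection $f_1\colon \mathrm{Eq}(f)\to X$ of its kernel pair, with the diagonal $X\to\mathrm{Eq}(f)$ as section, is an intrinsic Schreier split epimorphism. A sequence $K\xrightarrow{k}X\xrightarrow{f}Y$ is an intrinsic Schreier special extension if $f$ is a regular epimorphism and an intrinsic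 Schreier special morphism, and $k$ is a kernel of $f$. Consider a commutative diagram in $\mathcal C$ $$ \begin{array}{ccccc} K'' & \xrightarrow{k''} & X'' & \xrightarrow{f''} & Y''\\ {\scriptstyle w'}\downarrow & & {\scriptstyle u'}\downarrow & & \downarrow{\scriptstyle v'}\\ K' & \xrightarrow{k'} & X' & \xrightarrow{f'} & Y'\\ {\scriptstyle w}\downarrow & & {\scriptstyle u}\downarrow & & \downarrow{\scriptstyle v}\\ K & \xrightarrow{k} & X & \xrightarrow{f} & Y \end{array} $$ in which the three columns and the middle row are intrinsic Schreier special extensions. Then the upper row is an intrinsic Schreier special extension if and only if the lower row is. -/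

import Mathlib

open CategoryTheory CategoryTheory.Limits

namespace IntrinsicSchreier

universe v u

variable {C : Type u} [Category.{v} C]

/-- The counit of the comonad `P` is a regular epimorphism at each object (comonadic covers). -/
def HasComonadicCovers (P : Comonad C) : Prop :=
  ∀ X : C, IsRegularEpi (P.ε.app X)

/-- Projectivity with respect to the regular epimorphisms. -/
def IsRegularProjective (Q : C) : Prop :=
  ∀ ⦃X Y : C⦄ (e : X ⟶ Y) (g : Q ⟶ Y), IsRegularEpi e → ∃ l : Q ⟶ X, l ≫ e = g

/-- Two morphisms with the same codomain are jointly extremal-epimorphic: a monomorphism through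
which both of them factor is an isomorphism. -/
def JointlyExtremalEpi {A B Z : C} (a : A ⟶ Z) (b : B ⟶ Z) : Prop :=
  ∀ ⦃M : C⦄ (m : M ⟶ Z) (a' : A ⟶ M) (b' : B ⟶ M), Mono m → a' ≫ m = a → b' ≫ m = b → IsIso m

section Unital

variable (C) [HasZeroObject C] [HasZeroMorphisms C] [HasFiniteLimits C]

/-- A pointed finitely complete category is unital when the pairs `⟨1, 0⟩`, `⟨0, 1⟩` are jointly
extremal-epimorphic. -/
def IsUnital : Prop :=
  ∀ A B : C, JointlyExtremalEpi (prod.lift (𝟙 A) (0 : A ⟶ B)) (prod.lift (0 : B ⟶ A) (𝟙 B))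

end Unital

/-! ### Imaginary morphisms: the Kleisli category of the comonad -/

/-- Imaginary morphisms from `X` to `Y`. -/
abbrev ImHom (P : Comonad C) (X Y : C) : Type v := P.obj X ⟶ Y

/-- The imaginary morphism corresponding to a real morphism. -/
abbrev real (P : Comonad C) {X Y : C} (f : X ⟶ Y) : ImHom P X Y := P.ε.app X ≫ f

/-- Kleisli composition of imaginary morphisms (first `a`, then `b`). -/
abbrev imComp (P : Comonad C) {X Y Z : C} (a : ImHom P X Y) (b : ImHom P Y Z) : ImHom P X Z :=
  P.δ.app X ≫ P.map a ≫ b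

/-- The composition above is that of Mathlib's Kleisli category of a comonad. -/
theorem imComp_eq_cokleisli (P : Comonad C) {X Y Z : C} (a : ImHom P X Y) (b : ImHom P Y Z) :
    imComp P a b =
      (Cokleisli.Hom.mk a ≫ Cokleisli.Hom.mk b :
        Cokleisli.mk P X ⟶ Cokleisli.mk P Z).of := rfl

section Splitting

variable [HasZeroMorphisms C] [HasBinaryProducts C] [HasBinaryCoproducts C]

/-- The comparison morphism `A + B ⟶ A × B` given by the identity matrix. -/
noncomputable def comparison (A B : C) : A ⨿ B ⟶ A ⨯ B :=
  coprod.desc (prod.lift (𝟙 A) 0) (prod.lift 0 (𝟙 B))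

/-- A natural imaginary splitting: imaginary splittings of the comparison morphisms, natural in
both variables. -/
structure NaturalImaginarySplitting (P : Comonad C) where
  t : ∀ A B : C, ImHom P (A ⨯ B) (A ⨿ B)
  naturality : ∀ {A B A' B' : C} (a : A ⟶ A') (b : B ⟶ B'),
    P.map (prod.map a b) ≫ t A' B' = t A B ≫ coprod.map a b
  splitting : ∀ A B : C, t A B ≫ comparison A B = P.ε.app (A ⨯ B)

/-- The imaginary addition on `X`. -/
noncomputable def imAdd {P : Comonad C} (t : NaturalImaginarySplitting P) (X : C) :
    ImHom P (X ⨯ X) X :=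
  t.t X X ≫ coprod.desc (𝟙 X) (𝟙 X)

/-- The imaginary addition is associative (on imaginary generalized elements of every object).
The product in `C` is also the product in the Kleisli category, so `prod.lift` is the pairing of
imaginary morphisms. -/
def IsAssociative {P : Comonad C} (t : NaturalImaginarySplitting P) : Prop :=
  ∀ ⦃A X : C⦄ (a b c : ImHom P A X),
    imComp P (prod.lift (imComp P (prod.lift a b) (imAdd t X)) c) (imAdd t X) =
      imComp P (prod.lift a (imComp P (prod.lift b c) (imAdd t X))) (imAdd t X)

end Splitting

section Schreier

variable [HasZeroMorphisms C] [HasFiniteLimits C] [HasBinaryCoproducts C]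
variable {P : Comonad C} (t : NaturalImaginarySplitting P)

/-- `q` is an imaginary Schreier retraction for the morphisms `k : K ⟶ X`, `f : X ⟶ Y`,
`s : Y ⟶ X`. -/
structure IsImaginaryRetraction {K X Y : C} (k : K ⟶ X) (f : X ⟶ Y) (s : Y ⟶ X)
    (q : ImHom P X K) : Prop where
  add_retraction : imComp P (prod.lift (q ≫ k) (real P (f ≫ s))) (imAdd t X) = real P (𝟙 X)
  retraction_add : imComp P (P.map (prod.map k s) ≫ imAdd t X) q = real P (prod.fst : K ⨯ Y ⟶ K)

/-- The split epimorphism `f` with section `s` is intrinsic Schreier. The definition uses the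
chosen kernel of `f`; any other kernel gives an equivalent condition. -/
structure IsSchreierSplitEpi {X Y : C} (f : X ⟶ Y) (s : Y ⟶ X) : Prop where
  section_comp : s ≫ f = 𝟙 Y
  exists_retraction : ∃ q : ImHom P X (kernel f), IsImaginaryRetraction t (kernel.ι f) f s q

/-- `f` is an intrinsic Schreier special morphism: the first projection of its kernel pair, with
the diagonal as section, is an intrinsic Schreier split epimorphism. -/
def IsSchreierSpecialMorphism {X Y : C} (f : X ⟶ Y) : Prop :=
  IsSchreierSplitEpi t (pullback.fst f f) (pullback.diagonal f)

/-- `K ⟶ X ⟶ Y` is an intrinsic Schreier special extension: `f` is a regular epimorphism and an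
intrinsic Schreier special morphism, and `k` is a kernel of `f`. -/
structure IsSchreierSpecialExtension {K X Y : C} (k : K ⟶ X) (f : X ⟶ Y) : Prop where
  regularEpi : IsRegularEpi f
  special : IsSchreierSpecialMorphism t f
  isKernel : ∃ w : k ≫ f = 0, Nonempty (IsLimit (KernelFork.ofι k w))

end Schreier

end IntrinsicSchreier

open IntrinsicSchreier

/-! For each object `A`, associativity makes the imaginary morphisms from `A` to `X` a monoid,
functorially in `X`. A sequence in the category is an intrinsic Schreier special extension exactly
when, for every `A`, the induced sequence of monoids is a special Schreier extension
(`isSchreierSpecialExtension_iff`): projectivity turns regular epimorphisms into surjections, the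
covers `ε` bring statements on elements back to the category, and a Yoneda argument replaces the
imaginary retraction by unique solvability of `k z + x₁ = x₂`. What remains is the lemma for
monoids, a diagram chase in which subtraction is replaced by this left translation by elements of
the kernel. -/

/-- A sequence of monoids `K → X → Y` is a special Schreier extension: `f` is surjective with
kernel `k`, and two elements with the same image under `f` differ by a unique element of `K`. -/
structure IsSpecialSchreier {K X Y : Type*} [AddMonoid K] [AddMonoid X] [AddMonoid Y]
    (k : K →+ X) (f : X →+ Y) : Prop where
  surjective : Function.Surjective f
  map_zero : ∀ z, f (k z) = 0
  exact : ∀ x, f x = 0 → ∃ z, k z = x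
  existsUnique : ∀ x₁ x₂, f x₁ = f x₂ → ∃! z, k z + x₁ = x₂

namespace IsSpecialSchreier

section

variable {K X Y : Type*} [AddMonoid K] [AddMonoid X] [AddMonoid Y] {k : K →+ X} {f : X →+ Y}

/-- The kernel acts freely by left translation; this stands in for cancellation, which `X` need not
have. -/
theorem add_left_injective (h : IsSpecialSchreier k f) {z₁ z₂ : K} {x : X}
    (e : k z₁ + x = k z₂ + x) : z₁ = z₂ :=
  (h.existsUnique x (k z₂ + x) (by rw [f.map_add, h.map_zero, zero_add])).unique e rfl

theorem injective (h : IsSpecialSchreier k f) : Function.Injective k := fun z₁ z₂ e =>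
  h.add_left_injective (x := 0) (by rw [e])

theorem exists_add_eq (h : IsSpecialSchreier k f) {x₁ x₂ : X} (e : f x₁ = f x₂) :
    ∃ z, k z + x₁ = x₂ :=
  (h.existsUnique x₁ x₂ e).exists

theorem map_add_right (h : IsSpecialSchreier k f) (z : K) (x : X) : f (k z + x) = f x := by
  rw [f.map_add, h.map_zero, zero_add]

end

/-! ### The 3×3 lemma for monoids -/

section ThreeByThree

variable {K X Y K' X' Y' K'' X'' Y'' : Type*}
  [AddMonoid K] [AddMonoid X] [AddMonoid Y] [AddMonoid K'] [AddMonoid X'] [AddMonoid Y']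
  [AddMonoid K''] [AddMonoid X''] [AddMonoid Y'']
  {k'' : K'' →+ X''} {f'' : X'' →+ Y''} {k' : K' →+ X'} {f' : X' →+ Y'}
  {k : K →+ X} {f : X →+ Y}
  {w' : K'' →+ K'} {w : K' →+ K} {u' : X'' →+ X'} {u : X' →+ X} {v' : Y'' →+ Y'} {v : Y' →+ Y}

theorem upper_of_lower
    (c₁ : ∀ z, u' (k'' z) = k' (w' z)) (c₂ : ∀ x, v' (f'' x) = f' (u' x))
    (c₃ : ∀ z, u (k' z) = k (w z)) (c₄ : ∀ x, v (f' x) = f (u x))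
    (hw : IsSpecialSchreier w' w) (hu : IsSpecialSchreier u' u) (hv : IsSpecialSchreier v' v)
    (h' : IsSpecialSchreier k' f') (h : IsSpecialSchreier k f) : IsSpecialSchreier k'' f'' where
  surjective y := by
    obtain ⟨x', hx'⟩ := h'.surjective (v' y)
    obtain ⟨z, hz⟩ := h.exact (u x') (by rw [← c₄, hx', hv.map_zero])
    obtain ⟨z', rfl⟩ := hw.surjective z
    obtain ⟨x, hx⟩ := hu.exists_add_eq (x₁ := k' z') (x₂ := x') (by rw [c₃, hz])
    refine ⟨x, hv.injective ?_⟩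
    rw [c₂, ← hx', ← hx, f'.map_add, h'.map_zero, add_zero]
  map_zero z := hv.injective (by rw [c₂, c₁, h'.map_zero, v'.map_zero])
  exact x hx := by
    obtain ⟨z', hz'⟩ := h'.exact (u' x) (by rw [← c₂, hx, v'.map_zero])
    obtain ⟨z, hz⟩ := hw.exact z' (h.injective (by rw [← c₃, hz', hu.map_zero, k.map_zero]))
    exact ⟨z, hu.injective (by rw [c₁, hz, hz'])⟩
  existsUnique x₁ x₂ e := by
    obtain ⟨z', hz'⟩ := h'.exists_add_eq (x₁ := u' x₁) (x₂ := u' x₂) (by rw [← c₂, ← c₂, e])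
    -- Applying `u` gives `k (w z') = 0`, so `z'` comes from `K''`.
    have hz := congrArg u hz'
    rw [u.map_add, hu.map_zero, hu.map_zero, add_zero, c₃] at hz
    obtain ⟨z, hz⟩ := hw.exact z' (h.injective (by rw [hz, k.map_zero]))
    refine ⟨z, hu.injective ?_, fun z₁ hz₁ => hw.injective (h'.add_left_injective (x := u' x₁) ?_)⟩
    · rw [u'.map_add, c₁, hz, hz']
    · rw [hz, hz', ← c₁, ← u'.map_add]
      exact congrArg u' hz₁

theorem lower_of_upper
    (c₁ : ∀ z, u' (k'' z) = k' (w' z)) (c₂ : ∀ x, v' (f'' x) = f' (u' x))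
    (c₃ : ∀ z, u (k' z) = k (w z)) (c₄ : ∀ x, v (f' x) = f (u x))
    (hw : IsSpecialSchreier w' w) (hu : IsSpecialSchreier u' u) (hv : IsSpecialSchreier v' v)
    (h' : IsSpecialSchreier k' f') (h : IsSpecialSchreier k'' f'') : IsSpecialSchreier k f where
  surjective y := by
    obtain ⟨y', rfl⟩ := hv.surjective y
    obtain ⟨x', rfl⟩ := h'.surjective y'
    exact ⟨u x', (c₄ x').symm⟩
  map_zero z := by
    obtain ⟨z', rfl⟩ := hw.surjective z
    rw [← c₃, ← c₄, h'.map_zero, v.map_zero]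
  exact x hx := by
    obtain ⟨x', rfl⟩ := hu.surjective x
    obtain ⟨y'', hy⟩ := hv.exact (f' x') (by rw [c₄, hx])
    obtain ⟨x'', rfl⟩ := h.surjective y''
    obtain ⟨z', hz'⟩ := h'.exists_add_eq (x₁ := u' x'') (x₂ := x') (by rw [← c₂, hy])
    exact ⟨w z', by rw [← c₃, ← hz', u.map_add, hu.map_zero, add_zero]⟩
  existsUnique x₁ x₂ e := by
    refine existsUnique_of_exists_of_unique ?_ ?_
    · obtain ⟨x₁, rfl⟩ := hu.surjective x₁
      obtain ⟨x₂, rfl⟩ := hu.surjective x₂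
      -- The lifts need not agree under `f'`; translating `x₁` by a lift of the discrepancy in `Y''`
      -- makes them agree without changing its image under `u`.
      obtain ⟨y'', hy⟩ := hv.exists_add_eq (x₁ := f' x₁) (x₂ := f' x₂) (by rw [c₄, c₄, e])
      obtain ⟨x'', rfl⟩ := h.surjective y''
      obtain ⟨z', hz'⟩ := h'.exists_add_eq (x₁ := u' x'' + x₁) (x₂ := x₂)
        (by rw [f'.map_add, ← c₂, hy])
      exact ⟨w z', by rw [← hz', ← c₃, u.map_add, hu.map_add_right]⟩
    · rintro z₁ z₂ hz₁ hz₂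
      obtain ⟨x, rfl⟩ := hu.surjective x₁
      obtain ⟨z₁, rfl⟩ := hw.surjective z₁
      obtain ⟨z₂, rfl⟩ := hw.surjective z₂
      -- The two sums differ by some `u' x''`. Under `f'` both become `f' x`, so freeness in the
      -- right column puts `x''` in the image of `K''`, which `w` then kills.
      obtain ⟨x'', hx⟩ := hu.exists_add_eq (x₁ := k' z₁ + x) (x₂ := k' z₂ + x)
        (by rw [u.map_add, u.map_add, c₃, c₃, hz₁, hz₂])
      have hf := congrArg f' hx
      rw [f'.map_add, h'.map_add_right, h'.map_add_right, ← c₂] at hf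
      obtain ⟨z, rfl⟩ := h.exact x'' (hv.add_left_injective (x := f' x)
        (by rw [hf, v'.map_zero, zero_add]))
      rw [c₁, ← add_assoc, ← k'.map_add] at hx
      rw [← h'.add_left_injective hx, hw.map_add_right]

end ThreeByThree

end IsSpecialSchreier

namespace IntrinsicSchreier

universe v u

variable {C : Type u} [Category.{v} C]

/-! ### Composition of imaginary morphisms -/

section Kleisli

variable {P : Comonad C}

theorem imComp_comp {X Y Z W : C} (a : ImHom P X Y) (b : ImHom P Y Z) (f : Z ⟶ W) :
    imComp P a (b ≫ f) = imComp P a b ≫ f := by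
  simp [imComp]

theorem imComp_real {X Y Z : C} (a : ImHom P X Y) (f : Y ⟶ Z) : imComp P a (real P f) = a ≫ f := by
  simp [imComp, real, P.left_counit_assoc]

theorem real_imComp {X Y Z : C} (f : X ⟶ Y) (b : ImHom P Y Z) :
    imComp P (real P f) b = P.map f ≫ b := by
  simp [imComp, real, P.right_counit_assoc]

theorem imComp_assoc {W X Y Z : C} (a : ImHom P W X) (b : ImHom P X Y) (c : ImHom P Y Z) :
    imComp P (imComp P a b) c = imComp P a (imComp P b c) := by
  simp only [imComp, Functor.map_comp, Category.assoc, P.coassoc_assoc]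
  simp

theorem imComp_lift [HasBinaryProducts C] {W X Y Z : C} (a : ImHom P W X) (b : ImHom P X Y)
    (c : ImHom P X Z) :
    imComp P a (prod.lift b c) = prod.lift (imComp P a b) (imComp P a c) := by
  ext <;> simp [imComp]

end Kleisli

/-! ### The monoids of imaginary elements -/

section Addition

variable [HasZeroMorphisms C] [HasBinaryProducts C] [HasBinaryCoproducts C]
variable {P : Comonad C} (t : NaturalImaginarySplitting P)

/-- The sum of two imaginary morphisms. -/
noncomputable def imPlus {A X : C} (a b : ImHom P A X) : ImHom P A X :=
  imComp P (prod.lift a b) (imAdd t X)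

theorem imPlus_comp {A X Y : C} (a b : ImHom P A X) (f : X ⟶ Y) :
    imPlus t a b ≫ f = imPlus t (a ≫ f) (b ≫ f) := by
  have h : prod.lift (a ≫ f) (b ≫ f) = prod.lift a b ≫ prod.map f f := by simp
  rw [imPlus, imPlus, h]
  simp only [imComp, imAdd, Functor.map_comp, Category.assoc, reassoc_of% t.naturality f f]
  simp

theorem imComp_imPlus {A B X : C} (c : ImHom P B A) (a b : ImHom P A X) :
    imComp P c (imPlus t a b) = imPlus t (imComp P c a) (imComp P c b) := by
  rw [imPlus, imPlus, ← imComp_assoc, imComp_lift]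

/-- By naturality, adding zero applies the codiagonal after `1 + 0`, which is the first projection
after the comparison; the splitting then leaves only `ε`. -/
theorem imPlus_zero {A X : C} (a : ImHom P A X) : imPlus t a 0 = a := by
  have h : prod.lift a (0 : P.obj A ⟶ X) =
      prod.lift a (0 : P.obj A ⟶ X) ≫ prod.map (𝟙 X) (0 : X ⟶ X) := by simp
  have h' : coprod.map (𝟙 X) (0 : X ⟶ X) ≫ coprod.desc (𝟙 X) (𝟙 X) =
      comparison X X ≫ prod.fst := by
    ext <;> simp [comparison, coprod.inl_desc, coprod.inr_desc, prod.lift_fst]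
  rw [imPlus, h]
  simp only [imComp, imAdd, Functor.map_comp, Category.assoc,
    reassoc_of% t.naturality (𝟙 X) (0 : X ⟶ X), h',
    reassoc_of% t.splitting X X]
  simp [P.left_counit_assoc, prod.lift_fst]

theorem zero_imPlus {A X : C} (a : ImHom P A X) : imPlus t 0 a = a := by
  have h : prod.lift (0 : P.obj A ⟶ X) a =
      prod.lift (0 : P.obj A ⟶ X) a ≫ prod.map (0 : X ⟶ X) (𝟙 X) := by simp
  have h' : coprod.map (0 : X ⟶ X) (𝟙 X) ≫ coprod.desc (𝟙 X) (𝟙 X) =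
      comparison X X ≫ prod.snd := by
    ext <;> simp [comparison, coprod.inl_desc, coprod.inr_desc, prod.lift_snd]
  rw [imPlus, h]
  simp only [imComp, imAdd, Functor.map_comp, Category.assoc,
    reassoc_of% t.naturality (0 : X ⟶ X) (𝟙 X), h',
    reassoc_of% t.splitting X X]
  simp [P.left_counit_assoc, prod.lift_snd]

/-- The monoid of imaginary elements of `X` defined on `A`. -/
@[nolint unusedArguments]
def ImElement {t : NaturalImaginarySplitting P} (_ : IsAssociative t) (A X : C) : Type v :=
  ImHom P A X

variable {t} (ht : IsAssociative t)

noncomputable instance (A X : C) : AddMonoid (ImElement ht A X) where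
  add := imPlus t
  zero := (0 : P.obj A ⟶ X)
  add_assoc := ht (A := A) (X := X)
  zero_add := zero_imPlus t
  add_zero := imPlus_zero t
  nsmul := @nsmulRec _ ⟨(0 : P.obj A ⟶ X)⟩ ⟨imPlus t⟩

/-- The monoid homomorphism between imaginary elements induced by a morphism. -/
noncomputable def ImElement.map (A : C) {X Y : C} (f : X ⟶ Y) :
    ImElement ht A X →+ ImElement ht A Y where
  toFun a := (show P.obj A ⟶ X from a) ≫ f
  map_zero' := zero_comp
  map_add' a b := imPlus_comp t a b f

theorem ImElement.map_map {A X Y Y' Z : C} {f : X ⟶ Y} {g : Y ⟶ Z} {f' : X ⟶ Y'} {g' : Y' ⟶ Z}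
    (h : f ≫ g = f' ≫ g') (a : ImElement ht A X) :
    map ht A g (map ht A f a) = map ht A g' (map ht A f' a) := by
  change ((show P.obj A ⟶ X from a) ≫ f) ≫ g = ((show P.obj A ⟶ X from a) ≫ f') ≫ g'
  rw [Category.assoc, Category.assoc, h]

end Addition

/-! ### Schreier conditions on imaginary elements -/

section Special

variable [HasZeroMorphisms C] [HasFiniteLimits C] [HasBinaryCoproducts C]
variable {P : Comonad C} {t : NaturalImaginarySplitting P}

/-- Yoneda: the solution for `x` is the composite of `x` with `q`, and `q` is recovered as the
solution for the universal element `ε`. The second retraction identity encodes uniqueness. -/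
theorem isSchreierSplitEpi_iff {X Y : C} {f : X ⟶ Y} {s : Y ⟶ X} (hs : s ≫ f = 𝟙 Y) :
    IsSchreierSplitEpi t f s ↔
      ∀ (A : C) (x : ImHom P A X),
        ∃! z : ImHom P A (kernel f), imPlus t (z ≫ kernel.ι f) (x ≫ f ≫ s) = x := by
  constructor
  · rintro ⟨-, q, hq⟩ A x
    have hq₁ : imPlus t (q ≫ kernel.ι f) (real P (f ≫ s)) = real P (𝟙 X) := hq.add_retraction
    refine ⟨imComp P x q, ?_, fun z hz => ?_⟩
    · have := congrArg (imComp P x) hq₁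
      rwa [imComp_imPlus, imComp_comp, imComp_real, imComp_real, Category.comp_id] at this
    · have := congrArg (imComp P (prod.lift z (x ≫ f))) hq.retraction_add
      rw [imComp_real, prod.lift_fst, ← imComp_assoc, ← real_imComp, ← imComp_assoc, imComp_real,
        prod.lift_map, Category.assoc] at this
      rw [← this]
      exact congrArg (fun y => imComp P y q) hz
  · intro h
    obtain ⟨q, hq, -⟩ := h X (P.ε.app X)
    refine ⟨hs, q, by simpa [real, imPlus] using hq, ?_⟩
    have heq (A : C) (x : ImHom P A X) :
        imPlus t (imComp P x q ≫ kernel.ι f) (x ≫ f ≫ s) = x := by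
      have hε : P.ε.app X = real P (𝟙 X) := (Category.comp_id _).symm
      have := congrArg (imComp P x) hq
      rwa [imComp_imPlus, imComp_comp, imComp_comp, hε, imComp_real, Category.comp_id] at this
    have hsum : P.map (prod.map (kernel.ι f) s) ≫ imAdd t X =
        imPlus t (real P prod.fst ≫ kernel.ι f) (real P prod.snd ≫ s) := by
      rw [← real_imComp, imPlus]
      congr 1
      ext <;> simp [real, prod.lift_fst, prod.lift_snd]
    rw [hsum]
    -- Both sides solve the equation for the generic sum over `K × Y`.
    refine (h _ (imPlus t (real P prod.fst ≫ kernel.ι f) (real P prod.snd ≫ s))).unique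
      (heq _ _) ?_
    congr 1
    rw [imPlus_comp]
    simp only [Category.assoc]
    rw [reassoc_of% kernel.condition f, zero_comp, comp_zero, comp_zero, zero_imPlus, reassoc_of% hs]

/-- An element of the kernel pair is a pair `(x₁, x₂)`, and the kernel of the first projection is
`K` embedded as `(0, k)`. The split-epimorphism equation is automatic in the first component and
reads `k z + x₁ = x₂` in the second. -/
theorem isSchreierSpecialMorphism_iff {K X Y : C} {k : K ⟶ X} {f : X ⟶ Y} (w : k ≫ f = 0)
    (hk : IsLimit (KernelFork.ofι k w)) :
    IsSchreierSpecialMorphism t f ↔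
      ∀ (A : C) (x₁ x₂ : ImHom P A X), x₁ ≫ f = x₂ ≫ f →
        ∃! z : ImHom P A K, imPlus t (z ≫ k) x₁ = x₂ := by
  have : Mono k := Fork.IsLimit.mono hk
  have hdiag : pullback.diagonal f ≫ pullback.fst f f = 𝟙 X := pullback.diagonal_fst f
  rw [IsSchreierSpecialMorphism, isSchreierSplitEpi_iff hdiag]
  set ι := kernel.ι (pullback.fst f f)
  have hι₁ : ι ≫ pullback.fst f f = 0 := kernel.condition _
  let i : kernel (pullback.fst f f) ⟶ K := hk.lift (KernelFork.ofι (ι ≫ pullback.snd f f) (by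
    rw [Category.assoc, ← pullback.condition, reassoc_of% hι₁, zero_comp]))
  have hi : i ≫ k = ι ≫ pullback.snd f f := Fork.IsLimit.lift_ι hk
  let j : K ⟶ kernel (pullback.fst f f) :=
    kernel.lift _ (pullback.lift 0 k (by rw [w, zero_comp])) (pullback.lift_fst _ _ _)
  have hj : j ≫ ι ≫ pullback.snd f f = k := by
    rw [kernel.lift_ι_assoc, pullback.lift_snd]
  have hj₁ : j ≫ i = 𝟙 K := by rw [← cancel_mono k, Category.assoc, hi, hj, Category.id_comp]
  have hj₂ : i ≫ j = 𝟙 _ := by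
    rw [← cancel_mono ι]
    apply pullback.hom_ext
    · simp only [Category.assoc, hι₁, comp_zero]
    · simp only [Category.assoc, hj, hi, Category.id_comp]
  have key (A : C) (x : ImHom P A (pullback f f)) (z : ImHom P A (kernel (pullback.fst f f))) :
      imPlus t (z ≫ ι) (x ≫ pullback.fst f f ≫ pullback.diagonal f) = x ↔
        imPlus t ((z ≫ i) ≫ k) (x ≫ pullback.fst f f) = x ≫ pullback.snd f f := by
    constructor
    · intro h
      conv_rhs => rw [← h]
      simp [imPlus_comp, hi]
    · intro h
      apply pullback.hom_ext
      · simp [imPlus_comp, hι₁, zero_imPlus]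
      · rw [← h]
        simp [imPlus_comp, hi]
  constructor
  · intro h A x₁ x₂ e
    obtain ⟨z, hz, huniq⟩ := h A (pullback.lift x₁ x₂ e)
    rw [key] at hz
    refine ⟨z ≫ i, by simpa [pullback.lift_fst, pullback.lift_snd] using hz, fun z' hz' => ?_⟩
    rw [← huniq (z' ≫ j) ((key _ _ _).2
      (by simpa [hj₁, pullback.lift_fst, pullback.lift_snd] using hz')), Category.assoc, hj₁,
      Category.comp_id]
  · intro h A x
    obtain ⟨z, hz, huniq⟩ := h A (x ≫ pullback.fst f f) (x ≫ pullback.snd f f)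
      (by simp [pullback.condition])
    refine ⟨z ≫ j, (key _ _ _).2 (by simpa [hj₁] using hz), fun z' hz' => ?_⟩
    rw [← huniq (z' ≫ i) ((key _ _ _).1 hz'), Category.assoc, hj₂, Category.comp_id]

end Special

/-! ### Passing between extensions and monoids -/

section Regular

variable [Regular C] {P : Comonad C}

theorem isRegularEpi_iff_surjective (hP : HasComonadicCovers P)
    (hproj : ∀ X : C, IsRegularProjective (P.obj X)) {X Y : C} (f : X ⟶ Y) :
    IsRegularEpi f ↔ ∀ (A : C) (y : ImHom P A Y), ∃ x : ImHom P A X, x ≫ f = y := by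
  refine ⟨fun hf A y => hproj A f y hf, fun h => ?_⟩
  -- Lifting the cover of `Y` makes `f` the last factor of a strong epimorphism, hence strong, hence
  -- regular in a regular category.
  obtain ⟨x, hx⟩ := h Y (P.ε.app Y)
  have := hP Y
  have : StrongEpi (x ≫ f) := by rw [hx]; infer_instance
  have := strongEpi_of_strongEpi x f
  infer_instance

variable [HasZeroMorphisms C] [HasBinaryCoproducts C] {t : NaturalImaginarySplitting P}

/-- A sequence is an intrinsic Schreier special extension exactly when the sequences of monoids of
imaginary elements are special Schreier extensions. -/
theorem isSchreierSpecialExtension_iff (hP : HasComonadicCovers P)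
    (hproj : ∀ X : C, IsRegularProjective (P.obj X)) (ht : IsAssociative t)
    {K X Y : C} (k : K ⟶ X) (f : X ⟶ Y) :
    IsSchreierSpecialExtension t k f ↔
      ∀ A, IsSpecialSchreier (ImElement.map ht A k) (ImElement.map ht A f) := by
  constructor
  · rintro ⟨hf, hs, w, ⟨hk⟩⟩ A
    refine ⟨(isRegularEpi_iff_surjective hP hproj f).1 hf A, fun z => ?_, fun x hx => ?_,
      (isSchreierSpecialMorphism_iff w hk).1 hs A⟩
    · change ((show P.obj A ⟶ K from z) ≫ k) ≫ f = 0
      rw [Category.assoc, w, comp_zero]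
    · obtain ⟨l, hl⟩ := KernelFork.IsLimit.lift' hk (show P.obj A ⟶ X from x) hx
      exact ⟨l, hl⟩
  · intro h
    have hε (B : C) : StrongEpi (P.ε.app B) := by
      have := hP B
      infer_instance
    have w : k ≫ f = 0 := by
      rw [← cancel_epi (P.ε.app K), comp_zero, ← Category.assoc]
      exact (h K).map_zero (P.ε.app K)
    have hmono : Mono k := ⟨fun {B} a b hab => by
      rw [← cancel_epi (P.ε.app B)]
      refine (h B).injective ?_
      change (P.ε.app B ≫ a) ≫ k = (P.ε.app B ≫ b) ≫ k
      rw [Category.assoc, hab, Category.assoc]⟩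
    have hlift {B : C} (g : B ⟶ X) (hg : g ≫ f = 0) : ∃ l : B ⟶ K, l ≫ k = g := by
      obtain ⟨z, hz⟩ := (h B).exact (P.ε.app B ≫ g) (by
        change (P.ε.app B ≫ g) ≫ f = 0
        rw [Category.assoc, hg, comp_zero])
      have := hε B
      -- The factorization exists only over `P B`; it descends to `B` as the diagonal filler of the
      -- strong epimorphism `ε` against the monomorphism `k`.
      have sq : CommSq (show P.obj B ⟶ K from z) (P.ε.app B) k g := ⟨hz⟩
      exact ⟨sq.lift, sq.fac_right⟩
    have hk : IsLimit (KernelFork.ofι k w) :=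
      KernelFork.IsLimit.ofι' k w fun g hg => ⟨(hlift g hg).choose, (hlift g hg).choose_spec⟩
    exact ⟨(isRegularEpi_iff_surjective hP hproj f).2 fun A => (h A).surjective,
      (isSchreierSpecialMorphism_iff w hk).2 fun A => (h A).existsUnique, w, ⟨hk⟩⟩

end Regular

end IntrinsicSchreier

theorem mainTheorem10 {C : Type*} [Category* C] [Regular C] [HasZeroObject C]
    [HasZeroMorphisms C] [HasBinaryCoproducts C] (hC : IsUnital C)
    (P : Comonad C) (hP : HasComonadicCovers P) (t : NaturalImaginarySplitting P)
    (hproj : ∀ X : C, IsRegularProjective (P.obj X)) (hassoc : IsAssociative t)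
    {K X Y K' X' Y' K'' X'' Y'' : C}
    (k'' : K'' ⟶ X'') (f'' : X'' ⟶ Y'') (k' : K' ⟶ X') (f' : X' ⟶ Y')
    (k : K ⟶ X) (f : X ⟶ Y)
    (w' : K'' ⟶ K') (w : K' ⟶ K) (u' : X'' ⟶ X') (u : X' ⟶ X) (v' : Y'' ⟶ Y') (v : Y' ⟶ Y)
    (comm_upper_left : k'' ≫ u' = w' ≫ k') (comm_upper_right : f'' ≫ v' = u' ≫ f')
    (comm_lower_left : k' ≫ u = w ≫ k) (comm_lower_right : f' ≫ v = u ≫ f)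
    (left_column : IsSchreierSpecialExtension t w' w)
    (middle_column : IsSchreierSpecialExtension t u' u)
    (right_column : IsSchreierSpecialExtension t v' v)
    (middle_row : IsSchreierSpecialExtension t k' f') :
    IsSchreierSpecialExtension t k'' f'' ↔ IsSchreierSpecialExtension t k f := by
  have key {K X Y : C} (k : K ⟶ X) (f : X ⟶ Y) :=
    isSchreierSpecialExtension_iff hP hproj hassoc k f
  rw [key] at left_column middle_column right_column middle_row
  rw [key, key]
  have c₁ A := ImElement.map_map hassoc (A := A) comm_upper_left
  have c₂ A := ImElement.map_map hassoc (A := A) comm_upper_right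
  have c₃ A := ImElement.map_map hassoc (A := A) comm_lower_left
  have c₄ A := ImElement.map_map hassoc (A := A) comm_lower_right
  exact ⟨fun h A => IsSpecialSchreier.lower_of_upper (c₁ A) (c₂ A) (c₃ A) (c₄ A) (left_column A)
      (middle_column A) (right_column A) (middle_row A) (h A),
    fun h A => IsSpecialSchreier.upper_of_lower (c₁ A) (c₂ A) (c₃ A) (c₄ A) (left_column A)
      (middle_column A) (right_column A) (middle_row A) (h A)⟩
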